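/- Let $G=(V,E)$ be a finite simple graph and let $k\ge 1$ be an integer. A $k$-rainbow dominating function on $G$ is a function $f\colon V\to 2^{\{1,\dots,k\}}$ such that $\bigcup_{u\sim v}f(u)=\{1,\dots,k\}$ for every $v\in V$ with $f(v)=\emptyset$. Its weight is $w(f)=\sum_{v\in V}|f(v)|$. The $k$-rainbow domination number $\gamma_{rk}(G)$ is the minimum weight of a $k$-rainbow dominating function on $G$, and a $\gamma_{rk}(G)$-function is a $k$-rainbow dominating function of weight $\gamma_{rk}(G)$. For $m\ge 3$, the $m$-sided prism $\Pr(m)$ is the graph with vertex set $\{u_i,v_i : i\in\mathbb{Z}_m\}$ and edges $\{u_i,v_i\}$, $\{u_i,u_{i+1}\}$, $\{v_i,v_{i+1}\}$ for $i\in\mathbb{Z}_m$. **Theorem.** Let $m\ge 3$ and $G=\Pr(m)$. Then - $\gamma_{r1}(G)=\lceil m/2\rceil+1$ if $m\equiv 2\pmod 4$, and $\gamma_{r1}(G)=\lceil m/2\rceil$ otherwise. - $\gamma_{r2}(G)=m$. - $\gamma_{r3}(G)=m$ if $m\equiv 0\pmod 6$; $\gamma_{r3}(G)=m+1$ if $m\equiv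 1,2,3,5\pmod 6$; $\gamma_{r3}(G)=m+2$ if $m\equiv 4\pmod 6$. - $\gamma_{r4}(G)=\lceil 4m/3\rceil$ if $m\equiv 0,1\pmod 6$, and $\gamma_{r4}(G)=\lceil 4m/3\rceil+1$ if $m\equiv 2,3,4,5\pmod 6$. - $\gamma_{r5}(G)=\lceil 5m/3\rceil$ if $m\equiv 0,1,2,5\pmod 6$, and $\gamma_{r5}(G)=\lceil 5m/3\rceil+1$ if $m\equiv 3,4\pmod 6$. - $\gamma_{rk}(G)=2m$ for all $k\ge 6$. Moreover, for $m\equiv 0\pmod 6$ and $3\le k\le 6$ one has $\gamma_{rk}(G)=km/3$. Furthermore, for $k=4,5$ a $\gamma_{rk}(G)$-function is given as follows. Write $m=6t+s$ with $0\le s\le 5$. The columns $\left(\begin{smallmatrix} f(u_i)\\ f(v_i)\end{smallmatrix}\right)$, $i=0,\dots,m-1$, are the six columns of the array $A$ repeated $t$ times, followed by the $s$ columns of the array $B$. Here a string of digits such as $34$ stands for the set $\{3,4\}$, and $X=34$ if $k=4$, $X=345$ if $k=5$. - $s=0$, $k=4,5$: $A=\left(\begin{smallmatrix}\emptyset&X&\emptyset&1&\emptyset&2\\1&\emptyset&2&\emptyset&X&\emptyset\end{smallmatrix}\right)$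 ($B$ is empty). - $s=1$, $k=4,5$: $A=\left(\begin{smallmatrix}\emptyset&X&\emptyset&1&\emptyset&2\\1&\emptyset&2&\emptyset&X&\emptyset\end{smallmatrix}\right)$, $B=\left(\begin{smallmatrix}2\\1\end{smallmatrix}\right)$. - $s=2$, $k=4$: $A=\left(\begin{smallmatrix}\emptyset&1&\emptyset&34&\emptyset&2\\34&\emptyset&2&\emptyset&1&\emptyset\end{smallmatrix}\right)$, $B=\left(\begin{smallmatrix}\emptyset&2\\134&\emptyset\end{smallmatrix}\right)$. - $s=2$, $k=5$: $A=\left(\begin{smallmatrix}\emptyset&345&\emptyset&1&\emptyset&2\\1&\emptyset&2&\emptyset&345&\emptyset\end{smallmatrix}\right)$, $B=\left(\begin{smallmatrix}3&2\\1&4\end{smallmatrix}\right)$. - $s=3$, $k=4$: $A=\left(\begin{smallmatrix}\emptyset&34&\emptyset&2&\emptyset&1\\2&\emptyset&1&\emptyset&34&\emptyset\end{smallmatrix}\right)$, $B=\left(\begin{smallmatrix}\emptyset&34&1\\2&\emptyset&1\end{smallmatrix}\right)$. - $s=3$, $k=5$: $A=\left(\begin{smallmatrix}\emptyset&345&\emptyset&1&\emptyset&2\\1&\emptyset&2&\emptyset&345&\emptyset\end{smallmatrix}\right)$,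 $B=\left(\begin{smallmatrix}\emptyset&345&2\\1&\emptyset&2\end{smallmatrix}\right)$. - $s=4$, $k=4,5$: $A=\left(\begin{smallmatrix}\emptyset&2&\emptyset&1&\emptyset&X\\1&\emptyset&X&\emptyset&2&\emptyset\end{smallmatrix}\right)$, $B=\left(\begin{smallmatrix}\emptyset&12&\emptyset&X\\1&3&2&\emptyset\end{smallmatrix}\right)$. - $s=5$, $k=4$: $A=\left(\begin{smallmatrix}\emptyset&34&\emptyset&1&\emptyset&2\\1&\emptyset&2&\emptyset&34&\emptyset\end{smallmatrix}\right)$, $B=\left(\begin{smallmatrix}\emptyset&34&\emptyset&1&2\\1&\emptyset&2&\emptyset&34\end{smallmatrix}\right)$. - $s=5$, $k=5$: $A=\left(\begin{smallmatrix}\emptyset&2&\emptyset&1&\emptyset&345\\1&\emptyset&345&\emptyset&2&\emptyset\end{smallmatrix}\right)$, $B=\left(\begin{smallmatrix}\emptyset&2&1&\emptyset&345\\1&3&4&2&\emptyset\end{smallmatrix}\right)$. -/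

import Mathlib

namespace SimpleGraph

variable {V : Type*}

/-- `f` is a `k`-rainbow dominating function on `G`: it assigns to each vertex a subset of the
colour set `{1, …, k}`, and the neighbours of every uncoloured vertex jointly carry all colours. -/
def IsRainbowDominating (G : SimpleGraph V) (k : ℕ) (f : V → Finset ℕ) : Prop :=
  (∀ v, f v ⊆ Finset.Icc 1 k) ∧
    ∀ v, f v = ∅ → (⋃ u ∈ G.neighborSet v, (f u : Set ℕ)) = Set.Icc 1 k

/-- The weight `w(f) = ∑ |f(v)|`. -/
def rainbowWeight [Fintype V] (f : V → Finset ℕ) : ℕ := ∑ v, (f v).card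

/-- The `k`-rainbow domination number `γ_rk(G)`: the least weight of a `k`-rainbow dominating
function (see `isLeast_rainbowDominationNumber`). -/
noncomputable def rainbowDominationNumber [Fintype V] (G : SimpleGraph V) (k : ℕ) : ℕ :=
  sInf {w | ∃ f : V → Finset ℕ, G.IsRainbowDominating k f ∧ rainbowWeight f = w}

/-- The infimum above is a minimum. -/
theorem isLeast_rainbowDominationNumber [Fintype V] (G : SimpleGraph V) (k : ℕ) :
    IsLeast {w | ∃ f : V → Finset ℕ, G.IsRainbowDominating k f ∧ rainbowWeight f = w}
      (G.rainbowDominationNumber k) := by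
  refine ⟨Nat.sInf_mem ⟨_, fun _ => Finset.Icc 1 k, ⟨fun _ => subset_rfl, fun v hv => ?_⟩, rfl⟩,
    fun w hw => Nat.sInf_le hw⟩
  have h : Set.Icc 1 k = (∅ : Set ℕ) := by
    rw [← Finset.coe_Icc, show Finset.Icc 1 k = ∅ from hv, Finset.coe_empty]
  simp [h]

/-- A `γ_rk(G)`-function: a `k`-rainbow dominating function of minimum weight. -/
def IsGammaFunction [Fintype V] (G : SimpleGraph V) (k : ℕ) (f : V → Finset ℕ) : Prop :=
  G.IsRainbowDominating k f ∧ rainbowWeight f = G.rainbowDominationNumber k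

/-- The `m`-sided prism `Pr(m)`, with `u_i = Sum.inl i` and `v_i = Sum.inr i` for `i ∈ ℤ/m`;
its edges are `u_i v_i`, `u_i u_{i+1}` and `v_i v_{i+1}`. -/
def prism (m : ℕ) : SimpleGraph (ZMod m ⊕ ZMod m) :=
  SimpleGraph.fromEdgeSet
    {e | ∃ i : ZMod m, e = s(Sum.inl i, Sum.inr i) ∨
      e = s(Sum.inl i, Sum.inl (i + 1)) ∨ e = s(Sum.inr i, Sum.inr (i + 1))}

/-- A two-row array of colour sets: six columns (`uHead` over `vHead`), to be repeated, followed
by finitely many last columns (`uTail` over `vTail`). -/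
structure PrismPattern where
  uHead : List (Finset ℕ)
  vHead : List (Finset ℕ)
  uTail : List (Finset ℕ)
  vTail : List (Finset ℕ)

/-- The `j`-th entry of the row that repeats the six entries of `head` `t` times and then
continues with `tail`. -/
def patternRow (head tail : List (Finset ℕ)) (t j : ℕ) : Finset ℕ :=
  if j < 6 * t then head.getD (j % 6) ∅ else tail.getD (j - 6 * t) ∅

/-- The colouring of `Pr(m)` given by a pattern whose head is repeated `⌊m / 6⌋` times; the upper
row lists the values at `u_0, …, u_{m-1}`, the lower row those at `v_0, …, v_{m-1}`. -/
def PrismPattern.toFun (P : PrismPattern) (m : ℕ) : ZMod m ⊕ ZMod m → Finset ℕ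
  | Sum.inl i => patternRow P.uHead P.uTail (m / 6) i.val
  | Sum.inr i => patternRow P.vHead P.vTail (m / 6) i.val

/-- The table of patterns for four colours, by the residue of `m` modulo 6
(the last case is residue 5). -/
def prismPatternFour : ℕ → PrismPattern
  | 0 => ⟨[∅, {3, 4}, ∅, {1}, ∅, {2}],
          [{1}, ∅, {2}, ∅, {3, 4}, ∅],
          [],
          []⟩
  | 1 => ⟨[∅, {3, 4}, ∅, {1}, ∅, {2}],
          [{1}, ∅, {2}, ∅, {3, 4}, ∅],
          [{2}],
          [{1}]⟩
  | 2 => ⟨[∅, {1}, ∅, {3, 4}, ∅, {2}],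
          [{3, 4}, ∅, {2}, ∅, {1}, ∅],
          [∅, {2}],
          [{1, 3, 4}, ∅]⟩
  | 3 => ⟨[∅, {3, 4}, ∅, {2}, ∅, {1}],
          [{2}, ∅, {1}, ∅, {3, 4}, ∅],
          [∅, {3, 4}, {1}],
          [{2}, ∅, {1}]⟩
  | 4 => ⟨[∅, {2}, ∅, {1}, ∅, {3, 4}],
          [{1}, ∅, {3, 4}, ∅, {2}, ∅],
          [∅, {1, 2}, ∅, {3, 4}],
          [{1}, {3}, {2}, ∅]⟩
  | _ => ⟨[∅, {3, 4}, ∅, {1}, ∅, {2}],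
          [{1}, ∅, {2}, ∅, {3, 4}, ∅],
          [∅, {3, 4}, ∅, {1}, {2}],
          [{1}, ∅, {2}, ∅, {3, 4}]⟩

/-- The table of patterns for five colours, by the residue of `m` modulo 6
(the last case is residue 5). -/
def prismPatternFive : ℕ → PrismPattern
  | 0 => ⟨[∅, {3, 4, 5}, ∅, {1}, ∅, {2}],
          [{1}, ∅, {2}, ∅, {3, 4, 5}, ∅],
          [],
          []⟩
  | 1 => ⟨[∅, {3, 4, 5}, ∅, {1}, ∅, {2}],
          [{1}, ∅, {2}, ∅, {3, 4, 5}, ∅],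
          [{2}],
          [{1}]⟩
  | 2 => ⟨[∅, {3, 4, 5}, ∅, {1}, ∅, {2}],
          [{1}, ∅, {2}, ∅, {3, 4, 5}, ∅],
          [{3}, {2}],
          [{1}, {4}]⟩
  | 3 => ⟨[∅, {3, 4, 5}, ∅, {1}, ∅, {2}],
          [{1}, ∅, {2}, ∅, {3, 4, 5}, ∅],
          [∅, {3, 4, 5}, {2}],
          [{1}, ∅, {2}]⟩
  | 4 => ⟨[∅, {2}, ∅, {1}, ∅, {3, 4, 5}],
          [{1}, ∅, {3, 4, 5}, ∅, {2}, ∅],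
          [∅, {1, 2}, ∅, {3, 4, 5}],
          [{1}, {3}, {2}, ∅]⟩
  | _ => ⟨[∅, {2}, ∅, {1}, ∅, {3, 4, 5}],
          [{1}, ∅, {3, 4, 5}, ∅, {2}, ∅],
          [∅, {2}, {1}, ∅, {3, 4, 5}],
          [{1}, {3}, {4}, {2}, ∅]⟩

end SimpleGraph

/-!
Colour the two rows of the prism by sequences of sets `X i` and `Y i`, and call an edge
monochromatic if its two ends are both empty or both nonempty.

*Lower bounds for `3 ≤ k ≤ 6`.* A nonempty vertex of weight `w` sends `w / 3 - k / 18` to each of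
its three neighbours. Every vertex ends with charge at least `k / 6`, and every monochromatic edge
leaves a surplus of at least `(6 - k) / 9` (`discharge`). For `k = 6`, and hence for all `k ≥ 6`,
the bound `2 m` follows. For smaller `k` the monochromatic edges are counted. In one row their
number has the parity of `m` (`rowMono_mod_two`), so an odd prism has at least two of them, and this
suffices for odd `m`. For even `m` there are two cases.

* If every column has an empty vertex, the sets `X i ∪ Y i` have all colours in every window of three
  consecutive columns. So each colour occurs at least `⌈m / 3⌉` times, and the weight is at least
  `k ⌈m / 3⌉`.
* If some column has two nonempty vertices, there are at least three monochromatic edges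
  (`mono_of_full_column`). This is enough unless `m ≡ 1` modulo 3 and there are exactly three. Then
  the column is the only such column, and deleting one of its two vertices leaves a cyclic sequence
  in which only one window may miss a colour; counting the occurrences of each colour gives a better
  bound (`le_sum_card_of_windows_ne`).

*Lower bounds for `k ≤ 2`.* For two colours an empty column is paid for by its two neighbours. For
one colour, weight `m / 2` means that closed neighbourhoods partition the vertices, which forces the
pattern `u_i, v_{i+2}, u_{i+4}, …` and excludes `m ≡ 2` modulo 4.

*Upper bounds.* For `k ≥ 3` these are periodic patterns of period six followed by a few columns.
Three consecutive columns of a long pattern already occur in the repetition of the six columns or in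
the pattern that contains them once (`rowDominated_patternRow`), so finitely many cases remain, which
are decided by evaluation.
-/

namespace SimpleGraph

/-! ### Rainbow domination of a prism in terms of its two rows -/

/-- The rows `X` and `Y` of a prism are coloured by subsets of `{1, …, k}`, and every empty vertex
sees all colours on its three neighbours. -/
structure RowsDominate {m : ℕ} (k : ℕ) (X Y : ZMod m → Finset ℕ) : Prop where
  subset_left : ∀ i, X i ⊆ Finset.Icc 1 k
  subset_right : ∀ i, Y i ⊆ Finset.Icc 1 k
  left : ∀ i, X i = ∅ → X (i - 1) ∪ X (i + 1) ∪ Y i = Finset.Icc 1 k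
  right : ∀ i, Y i = ∅ → Y (i - 1) ∪ Y (i + 1) ∪ X i = Finset.Icc 1 k

theorem RowsDominate.symm {m k : ℕ} {X Y : ZMod m → Finset ℕ} (h : RowsDominate k X Y) :
    RowsDominate k Y X :=
  ⟨h.subset_right, h.subset_left, h.right, h.left⟩

theorem prism_neighborSet_inl {m : ℕ} (hm : 3 ≤ m) (i : ZMod m) :
    (prism m).neighborSet (Sum.inl i) = {Sum.inl (i - 1), Sum.inl (i + 1), Sum.inr i} := by
  have : Fact (1 < m) := ⟨by omega⟩
  have h1 : i ≠ i - 1 := fun h => one_ne_zero (sub_eq_self.1 h.symm)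
  have h2 : i ≠ i + 1 := fun h => one_ne_zero (left_eq_add.1 h)
  ext (j | j)
  · simp only [prism, mem_neighborSet, fromEdgeSet_adj, Set.mem_ofPred_eq, Sym2.eq_iff, ne_eq,
      Sum.inl.injEq, Set.mem_insert_iff, Set.mem_singleton_iff, reduceCtorEq, or_false]
    constructor
    · rintro ⟨⟨l, h⟩, -⟩
      rcases h with h | h | h
      · simp at h
      · rcases h with ⟨rfl, rfl⟩ | ⟨rfl, rfl⟩ <;> simp
      · simp at h
    · rintro (rfl | rfl)
      · exact ⟨⟨i - 1, by simp⟩, h1⟩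
      · exact ⟨⟨i, by simp⟩, h2⟩
  · simp only [prism, mem_neighborSet, fromEdgeSet_adj, Set.mem_ofPred_eq, Sym2.eq_iff]
    simp

theorem prism_neighborSet_inr {m : ℕ} (hm : 3 ≤ m) (i : ZMod m) :
    (prism m).neighborSet (Sum.inr i) = {Sum.inr (i - 1), Sum.inr (i + 1), Sum.inl i} := by
  have : Fact (1 < m) := ⟨by omega⟩
  have h1 : i ≠ i - 1 := fun h => one_ne_zero (sub_eq_self.1 h.symm)
  have h2 : i ≠ i + 1 := fun h => one_ne_zero (left_eq_add.1 h)
  ext (j | j)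
  · simp only [prism, mem_neighborSet, fromEdgeSet_adj, Set.mem_ofPred_eq, Sym2.eq_iff]
    simp
  · simp only [prism, mem_neighborSet, fromEdgeSet_adj, Set.mem_ofPred_eq, Sym2.eq_iff, ne_eq,
      Sum.inr.injEq, Set.mem_insert_iff, Set.mem_singleton_iff, reduceCtorEq, or_false]
    constructor
    · rintro ⟨⟨l, h⟩, -⟩
      rcases h with h | h | h
      · simp at h
      · simp at h
      · rcases h with ⟨rfl, rfl⟩ | ⟨rfl, rfl⟩ <;> simp
    · rintro (rfl | rfl)
      · exact ⟨⟨i - 1, by simp⟩, h1⟩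
      · exact ⟨⟨i, by simp⟩, h2⟩

theorem isRainbowDominating_prism_iff {m : ℕ} (hm : 3 ≤ m) (k : ℕ) (f : ZMod m ⊕ ZMod m → Finset ℕ) :
    (prism m).IsRainbowDominating k f ↔
      RowsDominate k (fun i => f (Sum.inl i)) (fun i => f (Sum.inr i)) := by
  have key : ∀ A B C : Finset ℕ, ((A : Set ℕ) ∪ (B ∪ C) = Set.Icc 1 k) ↔
      A ∪ B ∪ C = Finset.Icc 1 k := fun A B C => by
    rw [← Finset.coe_inj, Finset.coe_Icc, Finset.coe_union, Finset.coe_union, Set.union_assoc]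
  constructor
  · rintro ⟨h1, h2⟩
    refine ⟨fun i => h1 _, fun i => h1 _, fun i hi => ?_, fun i hi => ?_⟩
    · have := h2 _ hi
      rwa [prism_neighborSet_inl hm, Set.biUnion_insert, Set.biUnion_insert,
        Set.biUnion_singleton, key] at this
    · have := h2 _ hi
      rwa [prism_neighborSet_inr hm, Set.biUnion_insert, Set.biUnion_insert,
        Set.biUnion_singleton, key] at this
  · intro h
    refine ⟨?_, ?_⟩
    · rintro (i | i)
      exacts [h.subset_left i, h.subset_right i]
    · rintro (i | i) hi
      · rw [prism_neighborSet_inl hm, Set.biUnion_insert, Set.biUnion_insert,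
          Set.biUnion_singleton, key]
        exact h.left i hi
      · rw [prism_neighborSet_inr hm, Set.biUnion_insert, Set.biUnion_insert,
          Set.biUnion_singleton, key]
        exact h.right i hi

theorem rainbowWeight_prism {m : ℕ} [NeZero m] (f : ZMod m ⊕ ZMod m → Finset ℕ) :
    rainbowWeight f = ∑ i, (f (Sum.inl i)).card + ∑ i, (f (Sum.inr i)).card :=
  Fintype.sum_sum_type _

/-- To determine `γ_rk` of a prism, colour its rows with weight at most `n` and bound the weight of
all colourings below by `n`. -/
theorem rainbowDominationNumber_prism_eq {m : ℕ} [NeZero m] (hm : 3 ≤ m) {k n : ℕ}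
    (hup : ∃ X Y : ZMod m → Finset ℕ, RowsDominate k X Y ∧
      ∑ i, (X i).card + ∑ i, (Y i).card ≤ n)
    (hlow : ∀ X Y : ZMod m → Finset ℕ, RowsDominate k X Y →
      n ≤ ∑ i, (X i).card + ∑ i, (Y i).card) :
    (prism m).rainbowDominationNumber k = n := by
  obtain ⟨⟨f, hf, hw⟩, hmin⟩ := isLeast_rainbowDominationNumber (prism m) k
  obtain ⟨X, Y, hXY, hle⟩ := hup
  apply le_antisymm
  · refine le_trans (hmin ⟨Sum.elim X Y, ?_, rainbowWeight_prism _⟩) hle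
    exact (isRainbowDominating_prism_iff hm k _).2 hXY
  · rw [← hw, rainbowWeight_prism]
    exact hlow _ _ ((isRainbowDominating_prism_iff hm k f).1 hf)

theorem RowsDominate.le_card {m k : ℕ} {X Y : ZMod m → Finset ℕ} (h : RowsDominate k X Y)
    (i : ZMod m) (hi : (X i).card = 0) :
    k ≤ (X (i - 1)).card + (X (i + 1)).card + (Y i).card := by
  have h1 := congrArg Finset.card (h.left i (Finset.card_eq_zero.1 hi))
  rw [Nat.card_Icc, Nat.add_sub_cancel] at h1
  have h2 := Finset.card_union_le (X (i - 1) ∪ X (i + 1)) (Y i)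
  have h3 := Finset.card_union_le (X (i - 1)) (X (i + 1))
  omega

/-! ### Sums over a cycle and monochromatic edges -/

theorem sum_zmod_add_one {m : ℕ} [NeZero m] (g : ZMod m → ℕ) : ∑ i, g (i + 1) = ∑ i, g i :=
  Equiv.sum_comp (Equiv.addRight (1 : ZMod m)) g

theorem sum_zmod_sub_one {m : ℕ} [NeZero m] (g : ZMod m → ℕ) : ∑ i, g (i - 1) = ∑ i, g i :=
  Equiv.sum_comp (Equiv.subRight (1 : ZMod m)) g

theorem sum_zmod_window {m : ℕ} [NeZero m] (g : ZMod m → ℕ) :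
    ∑ i, (g (i - 1) + g i + g (i + 1)) = 3 * ∑ i, g i := by
  rw [Finset.sum_add_distrib, Finset.sum_add_distrib, sum_zmod_add_one, sum_zmod_sub_one]
  ring

/-- The indicator of an edge whose two ends, of weights `a` and `b`, are both empty or both
nonempty. Such an edge is called monochromatic below. -/
def sameIndicator (a b : ℕ) : ℕ := if (a = 0 ↔ b = 0) then 1 else 0

theorem sameIndicator_comm (a b : ℕ) : sameIndicator a b = sameIndicator b a := by
  simp only [sameIndicator, iff_comm]

/-- The number of monochromatic edges in one row. -/
def rowMono {m : ℕ} [NeZero m] (x : ZMod m → ℕ) : ℕ := ∑ i, sameIndicator (x i) (x (i + 1))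

/-- The number of monochromatic edges between the two rows. -/
def rungMono {m : ℕ} [NeZero m] (x y : ZMod m → ℕ) : ℕ := ∑ i, sameIndicator (x i) (y i)

/-- Around a cycle of length `m` the number of changes between empty and nonempty is even. -/
theorem rowMono_mod_two {m : ℕ} [NeZero m] (x : ZMod m → ℕ) : rowMono x % 2 = m % 2 := by
  let e : ZMod m → ℤ := fun i => if x i = 0 then 1 else -1
  have h1 : ∀ i, e i * e (i + 1) = (-1) ^ (1 + sameIndicator (x i) (x (i + 1))) := by
    intro i
    simp only [e, sameIndicator]
    by_cases h : x i = 0 <;> by_cases h' : x (i + 1) = 0 <;> simp [h, h']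
  have h2 : ∏ i, (e i * e (i + 1)) = 1 := by
    have h : ∏ i, e (i + 1) = ∏ i, e i := Equiv.prod_comp (Equiv.addRight (1 : ZMod m)) e
    rw [Finset.prod_mul_distrib, h, ← Finset.prod_mul_distrib]
    refine Finset.prod_eq_one fun i _ => ?_
    simp only [e]
    split_ifs <;> norm_num
  simp only [h1] at h2
  rw [Finset.prod_pow_eq_pow_sum, Finset.sum_add_distrib] at h2
  have h3 : (∑ _i : ZMod m, 1) = m := by simp [ZMod.card]
  rw [h3, neg_one_pow_eq_one_iff_even (by norm_num)] at h2
  have h4 : Even (m + rowMono x) := h2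
  rw [Nat.even_iff] at h4
  omega

theorem discharge_local {k : ℕ} (h3 : 3 ≤ k) (h6 : k ≤ 6) (p a b c : ℕ)
    (h : p = 0 → k ≤ a + b + c) :
    (6 - k) * (sameIndicator p a + sameIndicator p b + sameIndicator p c)
        + 3 * (k + if p = 0 then k else 0) ≤
      (6 * a + if a = 0 then k else 0) + (6 * b + if b = 0 then k else 0)
        + (6 * c + if c = 0 then k else 0) := by
  have e : ∀ q : ℕ, sameIndicator p q =
      if p = 0 then (if q = 0 then 1 else 0) else (if q = 0 then 0 else 1) := by
    intro q
    simp only [sameIndicator]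
    by_cases h : p = 0 <;> by_cases h' : q = 0 <;> simp [h, h']
  rw [e, e, e]
  interval_cases k <;> split_ifs <;> omega

/-- Sum of `discharge_local` over one row. -/
theorem discharge_row {m : ℕ} [NeZero m] {k : ℕ} (h3 : 3 ≤ k) (h6 : k ≤ 6) (x y : ZMod m → ℕ)
    (h : ∀ i, x i = 0 → k ≤ x (i - 1) + x (i + 1) + y i) :
    (6 - k) * (2 * rowMono x + rungMono x y) + 3 * (k * m + ∑ i, if x i = 0 then k else 0) ≤
      2 * (6 * ∑ i, x i + ∑ i, if x i = 0 then k else 0)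
        + (6 * ∑ i, y i + ∑ i, if y i = 0 then k else 0) := by
  have key := Finset.sum_le_sum fun i (_ : i ∈ (Finset.univ : Finset (ZMod m))) =>
    discharge_local h3 h6 (x i) (x (i - 1)) (x (i + 1)) (y i) (h i)
  have e1 : ∑ i, sameIndicator (x i) (x (i - 1)) = rowMono x := by
    rw [rowMono, ← sum_zmod_sub_one fun i => sameIndicator (x i) (x (i + 1))]
    refine Finset.sum_congr rfl fun i _ => ?_
    rw [sub_add_cancel, sameIndicator_comm]
  have e2 := sum_zmod_add_one fun i => (6 * x i + if x i = 0 then k else 0)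
  have e3 := sum_zmod_sub_one fun i => (6 * x i + if x i = 0 then k else 0)
  have e4 : (∑ _i : ZMod m, k) = k * m := by simp [ZMod.card, mul_comm]
  simp only [Finset.sum_add_distrib, ← Finset.mul_sum, e1, e4] at key e2 e3
  rw [e2, e3] at key
  change (6 - k) * (rowMono x + rowMono x + rungMono x y) + _ ≤ _ at key
  rw [two_mul, two_mul]
  exact key

/-- Discharging: a vertex of weight `w` sends `w / 3 - k / 18` to each of its neighbours when
`w > 0`, which leaves every vertex with charge at least `k / 6`; each end of a monochromatic edge
keeps a surplus of at least `(6 - k) / 18`. The inequality is scaled by 18. -/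
theorem discharge {m : ℕ} [NeZero m] {k : ℕ} (h3 : 3 ≤ k) (h6 : k ≤ 6) (x y : ZMod m → ℕ)
    (hx : ∀ i, x i = 0 → k ≤ x (i - 1) + x (i + 1) + y i)
    (hy : ∀ i, y i = 0 → k ≤ y (i - 1) + y (i + 1) + x i) :
    6 * (k * m) + (12 - 2 * k) * (rowMono x + rowMono y + rungMono x y) ≤
      18 * (∑ i, x i + ∑ i, y i) := by
  have h1 := discharge_row h3 h6 x y hx
  have h2 := discharge_row h3 h6 y x hy
  have e : rungMono y x = rungMono x y :=
    Finset.sum_congr rfl fun i _ => sameIndicator_comm _ _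
  rw [e] at h2
  have e2 : (12 - 2 * k) * (rowMono x + rowMono y + rungMono x y) =
      (6 - k) * (2 * rowMono x + rungMono x y) + (6 - k) * (2 * rowMono y + rungMono x y) := by
    rw [show 12 - 2 * k = (6 - k) * 2 by omega]
    ring
  rw [e2]
  omega

/-- The column `c` has two nonempty vertices, and few monochromatic edges: on an even cycle, they
number at least three, and if exactly three, then no other column has two nonempty vertices and
one of the rows is nonempty next to `c` on both sides. -/
theorem mono_of_full_column {m : ℕ} [NeZero m] (hm : 4 ≤ m) (hev : m % 2 = 0) (x y : ZMod m → ℕ)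
    (c : ZMod m) (hx : x c ≠ 0) (hy : y c ≠ 0) :
    3 ≤ rowMono x + rowMono y + rungMono x y ∧
      (rowMono x + rowMono y + rungMono x y = 3 →
        (∀ i, i ≠ c → x i = 0 ∨ y i = 0) ∧
          (x (c - 1) ≠ 0 ∧ x (c + 1) ≠ 0 ∨ y (c - 1) ≠ 0 ∧ y (c + 1) ≠ 0)) := by
  have px := rowMono_mod_two x
  have py := rowMono_mod_two y
  have hc : sameIndicator (x c) (y c) = 1 := by simp [sameIndicator, hx, hy]
  have hr : 1 ≤ rungMono x y := by
    rw [← hc]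
    exact Finset.single_le_sum (f := fun i => sameIndicator (x i) (y i))
      (fun _ _ => Nat.zero_le _) (Finset.mem_univ c)
  -- a row without monochromatic edges alternates
  have alt : ∀ z : ZMod m → ℕ, rowMono z = 0 → ∀ i, z (i + 1) = 0 ↔ z i ≠ 0 := by
    intro z hz i
    have := (Finset.sum_eq_zero_iff.1 hz) i (Finset.mem_univ i)
    simp only [sameIndicator] at this
    by_cases h : z i = 0 <;> by_cases h' : z (i + 1) = 0 <;> simp_all
  -- if only one rung is monochromatic, it is the one at `c`
  have only : rungMono x y = 1 → ∀ i, i ≠ c → (x i = 0 ↔ y i ≠ 0) := by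
    intro h1 i hi
    have h2 : ∑ j ∈ {i, c}, sameIndicator (x j) (y j) ≤ rungMono x y :=
      Finset.sum_le_sum_of_subset (Finset.subset_univ _)
    rw [Finset.sum_pair hi, hc, h1] at h2
    simp only [sameIndicator] at h2
    by_cases h : x i = 0 <;> by_cases h' : y i = 0 <;> simp_all
  have one_ne : (1 : ZMod m) ≠ 0 := by
    have : Fact (1 < m) := ⟨by omega⟩
    exact one_ne_zero
  have hcp : c + 1 ≠ c := by simpa using one_ne
  have hcm : c - 1 ≠ c := by simpa using one_ne
  have alone : ∀ z : ZMod m → ℕ, z c ≠ 0 → rowMono z = 0 → z (c - 1) = 0 ∧ z (c + 1) = 0 := by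
    intro z hz h0
    refine ⟨?_, (alt z h0 c).2 hz⟩
    by_contra hne
    have := (alt z h0 (c - 1)).2 hne
    rw [sub_add_cancel] at this
    exact hz this
  by_cases h0 : rowMono x = 0 ∧ rowMono y = 0
  · have hall : ∀ n : ℕ, x (c + n) = 0 ↔ y (c + n) = 0 := by
      intro n
      induction n with
      | zero => simp [hx, hy]
      | succ n ih =>
        push_cast
        rw [← add_assoc, alt x h0.1, alt y h0.2, Ne, Ne, ih]
    have hR : rungMono x y = m := by
      have : ∀ i, sameIndicator (x i) (y i) = 1 := by
        intro i
        have := hall (i - c).val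
        rw [ZMod.natCast_zmod_val, add_sub_cancel] at this
        simp [sameIndicator, this]
      simp [rungMono, this, ZMod.card]
    omega
  · refine ⟨by omega, fun hD => ?_⟩
    have hR : rungMono x y = 1 := by omega
    have hor : rowMono x = 0 ∨ rowMono y = 0 := by omega
    refine ⟨fun i hi => ?_, ?_⟩
    · have := only hR i hi
      by_cases h : x i = 0 <;> simp_all
    · rcases hor with h | h
      · obtain ⟨h1, h2⟩ := alone x hx h
        exact Or.inr ⟨(only hR _ hcm).1 h1, (only hR _ hcp).1 h2⟩
      · obtain ⟨h1, h2⟩ := alone y hy h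
        refine Or.inl ⟨fun hz => (only hR _ hcm).1 hz h1, fun hz => (only hR _ hcp).1 hz h2⟩

/-! ### Counting the occurrences of each colour -/

/-- The number of positions at which the colour `a` occurs. -/
def occurrences {m : ℕ} [NeZero m] (Z : ZMod m → Finset ℕ) (a : ℕ) : ℕ :=
  ∑ i, if a ∈ Z i then 1 else 0

/-- The number of occurrences of the colour `a` in the three positions around `i`. -/
def windowCount {m : ℕ} (Z : ZMod m → Finset ℕ) (a : ℕ) (i : ZMod m) : ℕ :=
  (if a ∈ Z (i - 1) then 1 else 0) + (if a ∈ Z i then 1 else 0) + (if a ∈ Z (i + 1) then 1 else 0)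

theorem sum_windowCount {m : ℕ} [NeZero m] (Z : ZMod m → Finset ℕ) (a : ℕ) :
    ∑ i, windowCount Z a i = 3 * occurrences Z a :=
  sum_zmod_window fun i => if a ∈ Z i then 1 else 0

theorem sum_occurrences_le {m : ℕ} [NeZero m] (Z : ZMod m → Finset ℕ) (s : Finset ℕ) :
    ∑ a ∈ s, occurrences Z a ≤ ∑ i, (Z i).card := by
  simp only [occurrences]
  rw [Finset.sum_comm]
  refine Finset.sum_le_sum fun i _ => ?_
  rw [← Finset.card_filter]
  exact Finset.card_le_card fun a ha => (Finset.mem_filter.1 ha).2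

theorem windowCount_pos {m : ℕ} (Z : ZMod m → Finset ℕ) (a : ℕ) (i : ZMod m)
    (h : a ∈ Z (i - 1) ∪ Z i ∪ Z (i + 1)) : 1 ≤ windowCount Z a i := by
  simp only [Finset.mem_union] at h
  simp only [windowCount]
  rcases h with (h | h) | h <;> simp only [h, if_true] <;> omega

/-- If every window of three positions has all colours, then each colour occurs at least `⌈m / 3⌉`
times. -/
theorem le_sum_card_of_windows {m : ℕ} [NeZero m] {k : ℕ} (Z : ZMod m → Finset ℕ)
    (h : ∀ i, Finset.Icc 1 k ⊆ Z (i - 1) ∪ Z i ∪ Z (i + 1)) :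
    k * ((m + 2) / 3) ≤ ∑ i, (Z i).card := by
  refine le_trans ?_ (sum_occurrences_le Z (Finset.Icc 1 k))
  have : ∀ a ∈ Finset.Icc 1 k, (m + 2) / 3 ≤ occurrences Z a := by
    intro a ha
    have h1 := Finset.sum_le_sum fun i (_ : i ∈ (Finset.univ : Finset (ZMod m))) =>
      windowCount_pos Z a i (h i ha)
    rw [sum_windowCount] at h1
    simp only [Finset.sum_const, Finset.card_univ, ZMod.card, smul_eq_mul, mul_one] at h1
    omega
  have h2 := Finset.card_nsmul_le_sum _ _ _ this
  rwa [Nat.card_Icc, Nat.add_sub_cancel, smul_eq_mul] at h2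

/-- One window, around `c`, need not contain all colours, but its three sets are nonempty. For
`m = 3 n + 1` every colour still occurs `n` times; a colour in the window around `c` occurs `n + 1`
times, and `n + 2` times if it is the only colour there. -/
theorem le_sum_card_of_windows_ne {m : ℕ} [NeZero m] {k n : ℕ} (hmn : m = 3 * n + 1) (hn : 1 ≤ n)
    (Z : ZMod m → Finset ℕ) (c : ZMod m) (hsub : ∀ i, Z i ⊆ Finset.Icc 1 k)
    (h : ∀ i, i ≠ c → Finset.Icc 1 k ⊆ Z (i - 1) ∪ Z i ∪ Z (i + 1))
    (h0 : (Z c).Nonempty) (hl : (Z (c - 1)).Nonempty) (hr : (Z (c + 1)).Nonempty) :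
    k * n + 2 ≤ ∑ i, (Z i).card := by
  have hcp : c + 1 ≠ c := by
    have : Fact (1 < m) := ⟨by omega⟩
    exact fun h => one_ne_zero (add_eq_left.1 h)
  refine le_trans ?_ (sum_occurrences_le Z (Finset.Icc 1 k))
  have hbase : ∀ a ∈ Finset.Icc 1 k, m - 1 + windowCount Z a c ≤ 3 * occurrences Z a := by
    intro a ha
    rw [← sum_windowCount, ← Finset.sum_erase_add _ _ (Finset.mem_univ c)]
    have h1 := Finset.card_nsmul_le_sum (Finset.univ.erase c) (fun i => windowCount Z a i) 1
      fun i hi => windowCount_pos Z a i (h i (Finset.ne_of_mem_erase hi) ha)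
    rw [Finset.card_erase_of_mem (Finset.mem_univ c), Finset.card_univ, ZMod.card, smul_eq_mul,
      mul_one] at h1
    omega
  have hone : ∀ a ∈ Z (c - 1) ∪ Z c ∪ Z (c + 1), n + 1 ≤ occurrences Z a := by
    intro a ha
    have hk : a ∈ Finset.Icc 1 k := by
      simp only [Finset.mem_union] at ha
      rcases ha with (ha | ha) | ha <;> exact hsub _ ha
    have := hbase a hk
    have := windowCount_pos Z a c ha
    omega
  have hle : ∀ a ∈ Finset.Icc 1 k, n ≤ occurrences Z a := fun a ha => by
    have := hbase a ha
    omega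
  -- it remains to find an excess of two over `n` occurrences of each colour
  suffices hex : 2 ≤ ∑ a ∈ Finset.Icc 1 k, (occurrences Z a - n) by
    have h1 : ∑ a ∈ Finset.Icc 1 k, occurrences Z a =
        ∑ a ∈ Finset.Icc 1 k, (n + (occurrences Z a - n)) :=
      Finset.sum_congr rfl fun a ha => by
        have := hle a ha
        omega
    rw [h1, Finset.sum_add_distrib, Finset.sum_const, Nat.card_Icc, smul_eq_mul,
      Nat.add_sub_cancel]
    omega
  have htwo : ∀ a ∈ Z (c - 1) ∪ Z c ∪ Z (c + 1), ∀ b ∈ Z c, a ≠ b →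
      2 ≤ ∑ a ∈ Finset.Icc 1 k, (occurrences Z a - n) := by
    intro a ha b hb hab
    have hak : a ∈ Finset.Icc 1 k := by
      simp only [Finset.mem_union] at ha
      rcases ha with (ha | ha) | ha <;> exact hsub _ ha
    have h1 := hone a ha
    have h2 := hone b (by simp [hb])
    have h3 : ∑ a ∈ {a, b}, (occurrences Z a - n) ≤
        ∑ a ∈ Finset.Icc 1 k, (occurrences Z a - n) := by
      refine Finset.sum_le_sum_of_subset ?_
      intro x hx
      simp only [Finset.mem_insert, Finset.mem_singleton] at hx
      rcases hx with rfl | rfl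
      exacts [hak, hsub _ hb]
    rw [Finset.sum_pair hab] at h3
    omega
  obtain ⟨b, hb⟩ := h0
  obtain ⟨a, ha⟩ := hl
  obtain ⟨d, hd⟩ := hr
  by_cases hab : a = b
  · by_cases hdb : d = b
    · subst hab hdb
      have h1 : windowCount Z d c = 3 := by simp [windowCount, ha, hb, hd]
      have h2 : 2 ≤ windowCount Z d (c + 1) := by
        simp only [windowCount, add_sub_cancel_right, hb, hd, if_true]
        omega
      have h3 := Finset.card_nsmul_le_sum ((Finset.univ.erase c).erase (c + 1))
        (fun i => windowCount Z d i) 1 fun i hi => windowCount_pos Z d i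
          (h i (Finset.ne_of_mem_erase (Finset.mem_of_mem_erase hi)) (hsub _ hb))
      have h4 : c + 1 ∈ Finset.univ.erase c := Finset.mem_erase.2 ⟨hcp, Finset.mem_univ _⟩
      rw [Finset.card_erase_of_mem h4, Finset.card_erase_of_mem (Finset.mem_univ c),
        Finset.card_univ, ZMod.card, smul_eq_mul, mul_one] at h3
      have h5 := sum_windowCount Z d
      rw [← Finset.sum_erase_add _ _ (Finset.mem_univ c), ← Finset.sum_erase_add _ _ h4] at h5
      have h6 := Finset.single_le_sum (f := fun a => occurrences Z a - n)
        (fun _ _ => Nat.zero_le _) (hsub _ hb)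
      have h7 : occurrences Z d - n ≤ ∑ a ∈ Finset.Icc 1 k, (occurrences Z a - n) := h6
      omega
    · exact htwo d (by simp [hd]) b hb hdb
  · exact htwo a (by simp [ha]) b hb hab

/-! ### Lower bounds -/

theorem RowsDominate.discharge {m : ℕ} [NeZero m] {k : ℕ} (h3 : 3 ≤ k) (h6 : k ≤ 6)
    {X Y : ZMod m → Finset ℕ} (h : RowsDominate k X Y) :
    6 * (k * m) + (12 - 2 * k) * (rowMono (fun i => (X i).card) + rowMono (fun i => (Y i).card)
        + rungMono (fun i => (X i).card) (fun i => (Y i).card)) ≤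
      18 * (∑ i, (X i).card + ∑ i, (Y i).card) :=
  SimpleGraph.discharge h3 h6 _ _ h.le_card h.symm.le_card

/-- Each row of an odd prism has a monochromatic edge. -/
theorem RowsDominate.le_weight_of_odd {m : ℕ} [NeZero m] {k : ℕ} (h3 : 3 ≤ k) (h6 : k ≤ 6)
    (hodd : m % 2 = 1) {X Y : ZMod m → Finset ℕ} (h : RowsDominate k X Y) :
    6 * (k * m) + (24 - 4 * k) ≤ 18 * (∑ i, (X i).card + ∑ i, (Y i).card) := by
  refine le_trans ?_ (h.discharge h3 h6)
  have h1 := rowMono_mod_two fun i => (X i).card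
  have h2 := rowMono_mod_two fun i => (Y i).card
  have : (12 - 2 * k) * 2 ≤ (12 - 2 * k) * (rowMono (fun i => (X i).card) +
      rowMono (fun i => (Y i).card) + rungMono (fun i => (X i).card) (fun i => (Y i).card)) :=
    Nat.mul_le_mul_left _ (by omega)
  omega

theorem RowsDominate.le_weight_of_not_full {m : ℕ} [NeZero m] {k : ℕ}
    {X Y : ZMod m → Finset ℕ} (h : RowsDominate k X Y) (hempty : ∀ i, X i = ∅ ∨ Y i = ∅) :
    k * ((m + 2) / 3) ≤ ∑ i, (X i).card + ∑ i, (Y i).card := by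
  refine le_trans (le_sum_card_of_windows (fun i => X i ∪ Y i) fun i => ?_) ?_
  · rcases hempty i with hi | hi
    · rw [← h.left i hi]
      intro a
      simp only [Finset.mem_union]
      tauto
    · rw [← h.right i hi]
      intro a
      simp only [Finset.mem_union]
      tauto
  · rw [← Finset.sum_add_distrib]
    exact Finset.sum_le_sum fun i _ => Finset.card_union_le _ _

/-- If `c` is the only column with two nonempty vertices, drop its vertex in the row that is
nonempty next to `c` on both sides. Then the neighbours of the empty vertex of any other column
form a window of the remaining sequence of sets. -/
theorem RowsDominate.le_weight_of_one_full {m : ℕ} [NeZero m] {k n : ℕ} (hmn : m = 3 * n + 1)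
    (hn : 1 ≤ n) {X Y : ZMod m → Finset ℕ} (h : RowsDominate k X Y) (c : ZMod m)
    (hXc : X c ≠ ∅) (hYc : Y c ≠ ∅) (hempty : ∀ i, i ≠ c → X i = ∅ ∨ Y i = ∅)
    (hl : X (c - 1) ≠ ∅) (hr : X (c + 1) ≠ ∅) :
    k * n + 3 ≤ ∑ i, (X i).card + ∑ i, (Y i).card := by
  have : Fact (1 < m) := ⟨by omega⟩
  have hcp : c + 1 ≠ c := fun h => one_ne_zero (add_eq_left.1 h)
  have hcm : c - 1 ≠ c := fun h => one_ne_zero (sub_eq_self.1 h)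
  let Z : ZMod m → Finset ℕ := fun i => if i = c then Y i else X i ∪ Y i
  have hZY : ∀ i, Y i ⊆ Z i := by
    intro i
    simp only [Z]
    split_ifs
    exacts [subset_rfl, Finset.subset_union_right]
  have hZX : ∀ i, i ≠ c → X i ⊆ Z i := by
    intro i hi
    simp only [Z, if_neg hi]
    exact Finset.subset_union_left
  have key : k * n + 2 ≤ ∑ i, (Z i).card := by
    refine le_sum_card_of_windows_ne hmn hn Z c (fun i => ?_) (fun i hi => ?_) ?_ ?_ ?_
    · simp only [Z]
      split_ifs
      exacts [h.subset_right i, Finset.union_subset (h.subset_left i) (h.subset_right i)]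
    · rcases hempty i hi with hXY | hXY
      · rw [← h.left i hXY]
        have h1 : i - 1 ≠ c := by
          rintro rfl
          rw [sub_add_cancel] at hr
          exact hr hXY
        have h2 : i + 1 ≠ c := by
          rintro rfl
          rw [add_sub_cancel_right] at hl
          exact hl hXY
        intro a ha
        simp only [Finset.mem_union] at ha ⊢
        rcases ha with (ha | ha) | ha
        exacts [Or.inl (Or.inl (hZX _ h1 ha)), Or.inr (hZX _ h2 ha), Or.inl (Or.inr (hZY _ ha))]
      · rw [← h.right i hXY]
        intro a ha
        simp only [Finset.mem_union] at ha ⊢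
        rcases ha with (ha | ha) | ha
        exacts [Or.inl (Or.inl (hZY _ ha)), Or.inr (hZY _ ha), Or.inl (Or.inr (hZX _ hi ha))]
    · exact (Finset.nonempty_iff_ne_empty.2 hYc).mono (hZY c)
    · exact (Finset.nonempty_iff_ne_empty.2 hl).mono (hZX _ hcm)
    · exact (Finset.nonempty_iff_ne_empty.2 hr).mono (hZX _ hcp)
  have h1 : ∑ i, (Z i).card + (X c).card ≤ ∑ i, ((X i).card + (Y i).card) := by
    rw [← Finset.sum_erase_add _ _ (Finset.mem_univ c), ← Finset.sum_erase_add _ _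
      (Finset.mem_univ c)]
    have h2 : ∑ i ∈ Finset.univ.erase c, (Z i).card ≤
        ∑ i ∈ Finset.univ.erase c, ((X i).card + (Y i).card) := by
      refine Finset.sum_le_sum fun i hi => ?_
      simp only [Z, if_neg (Finset.ne_of_mem_erase hi)]
      exact Finset.card_union_le _ _
    have h3 : (Z c).card = (Y c).card := by simp [Z]
    omega
  rw [Finset.sum_add_distrib] at h1
  have h2 : 0 < (X c).card := Finset.card_pos.2 (Finset.nonempty_iff_ne_empty.2 hXc)
  omega

/-- On an even prism, either every column has an empty vertex and counting each colour applies, or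
there are at least three monochromatic edges; for `m ≡ 1` modulo 3 the discharging bound that
results from exactly three of them is not attained. -/
theorem RowsDominate.le_weight_of_even {m : ℕ} [NeZero m] {k : ℕ} (hm : 4 ≤ m) (h3 : 3 ≤ k)
    (h5 : k ≤ 5) (hev : m % 2 = 0) {X Y : ZMod m → Finset ℕ} (h : RowsDominate k X Y) :
    k * ((m + 2) / 3) ≤ ∑ i, (X i).card + ∑ i, (Y i).card ∨
      6 * (k * m) + (36 - 6 * k) ≤ 18 * (∑ i, (X i).card + ∑ i, (Y i).card) ∧
        (m % 3 = 1 →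
          6 * (k * m) + (36 - 6 * k) < 18 * (∑ i, (X i).card + ∑ i, (Y i).card)) := by
  by_cases hempty : ∀ i, X i = ∅ ∨ Y i = ∅
  · exact Or.inl (h.le_weight_of_not_full hempty)
  right
  push Not at hempty
  obtain ⟨c, hX, hY⟩ := hempty
  have hXc := Finset.nonempty_iff_ne_empty.1 hX
  have hYc := Finset.nonempty_iff_ne_empty.1 hY
  obtain ⟨hD3, hD⟩ := mono_of_full_column hm hev (fun i => (X i).card) (fun i => (Y i).card) c
    (by simpa using hXc) (by simpa using hYc)
  have hdis := h.discharge h3 (by omega)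
  set D := rowMono (fun i => (X i).card) + rowMono (fun i => (Y i).card)
    + rungMono (fun i => (X i).card) (fun i => (Y i).card)
  have hmul : (12 - 2 * k) * 3 ≤ (12 - 2 * k) * D := Nat.mul_le_mul_left _ hD3
  refine ⟨by omega, fun hm1 => ?_⟩
  rcases hD3.lt_or_eq with hlt | heq
  · have : (12 - 2 * k) * 4 ≤ (12 - 2 * k) * D := Nat.mul_le_mul_left _ hlt
    omega
  · obtain ⟨n, hn⟩ : ∃ n, m = 3 * n + 1 := ⟨m / 3, by omega⟩
    obtain ⟨h1, h2⟩ := hD heq.symm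
    simp only [Finset.card_eq_zero, ne_eq] at h1 h2
    have key : k * n + 3 ≤ ∑ i, (X i).card + ∑ i, (Y i).card := by
      rcases h2 with h2 | h2
      · exact h.le_weight_of_one_full hn (by omega) c hXc hYc h1 h2.1 h2.2
      · rw [add_comm (∑ i, (X i).card)]
        exact h.symm.le_weight_of_one_full hn (by omega) c hYc hXc (fun i hi => (h1 i hi).symm)
          h2.1 h2.2
    have e : k * m = 3 * (k * n) + k := by
      rw [hn]
      ring
    omega

theorem RowsDominate.le_weight_two {m : ℕ} [NeZero m] {X Y : ZMod m → Finset ℕ}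
    (h : RowsDominate 2 X Y) : m ≤ ∑ i, (X i).card + ∑ i, (Y i).card := by
  let z : ZMod m → ℕ := fun i => (X i).card + (Y i).card
  -- a column of weight `z` sends `(z - 1) / 2` to each of its two neighbours
  have hloc : ∀ i, 2 ≤ 2 * min (z i) 1 + (z (i - 1) - 1) + (z (i + 1) - 1) := by
    intro i
    by_cases hz : z i = 0
    · have h1 := h.le_card i (by simp only [z] at hz; omega)
      have h2 := h.symm.le_card i (by simp only [z] at hz; omega)
      simp only [z] at hz ⊢
      omega
    · omega
  have h1 := Finset.sum_le_sum fun i (_ : i ∈ (Finset.univ : Finset (ZMod m))) => hloc i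
  rw [Finset.sum_add_distrib, Finset.sum_add_distrib, sum_zmod_sub_one fun i => z i - 1,
    sum_zmod_add_one fun i => z i - 1, ← Finset.sum_add_distrib, ← Finset.sum_add_distrib] at h1
  have h2 : ∑ i, (2 * min (z i) 1 + (z i - 1) + (z i - 1)) = 2 * ∑ i, z i := by
    rw [Finset.mul_sum]
    exact Finset.sum_congr rfl fun i _ => by omega
  simp only [Finset.sum_const, Finset.card_univ, ZMod.card, smul_eq_mul] at h1
  rw [h2, show ∑ i, z i = _ from Finset.sum_add_distrib] at h1
  omega

/-- A domination of `Pr(m)` has weight at least `m / 2`. In case of equality every closed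
neighbourhood has weight one, and then the nonempty vertices are at `u_i, v_{i+2}, u_{i+4}, …`, so
that `m` is not `2` modulo `4`. -/
theorem RowsDominate.le_weight_one {m : ℕ} [NeZero m] {X Y : ZMod m → Finset ℕ}
    (h : RowsDominate 1 X Y) :
    m ≤ 2 * (∑ i, (X i).card + ∑ i, (Y i).card) ∧
      (m % 4 = 2 → m ≠ 2 * (∑ i, (X i).card + ∑ i, (Y i).card)) := by
  let x : ZMod m → ℕ := fun i => (X i).card
  let y : ZMod m → ℕ := fun i => (Y i).card
  have hx : ∀ i, 1 ≤ x (i - 1) + x i + x (i + 1) + y i := by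
    intro i
    by_cases hz : x i = 0
    · have h1 := h.le_card i hz
      simp only [x, y] at hz ⊢
      omega
    · omega
  have hy : ∀ i, 1 ≤ y (i - 1) + y i + y (i + 1) + x i := by
    intro i
    by_cases hz : y i = 0
    · have h1 := h.symm.le_card i hz
      simp only [x, y] at hz ⊢
      omega
    · omega
  have hxy : ∑ i, ((x (i - 1) + x i + x (i + 1) + y i) + (y (i - 1) + y i + y (i + 1) + x i)) =
      4 * (∑ i, x i + ∑ i, y i) := by
    rw [Finset.sum_add_distrib, Finset.sum_add_distrib, Finset.sum_add_distrib (g := x),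
      sum_zmod_window x, sum_zmod_window y]
    ring
  have htwo : ∑ _i : ZMod m, 2 = 2 * m := by simp [ZMod.card, mul_comm]
  have hle : ∀ i ∈ (Finset.univ : Finset (ZMod m)),
      2 ≤ (x (i - 1) + x i + x (i + 1) + y i) + (y (i - 1) + y i + y (i + 1) + x i) := by
    intro i _
    have h1 := hx i
    have h2 := hy i
    omega
  have hsum := Finset.sum_le_sum hle
  rw [hxy, htwo] at hsum
  change m ≤ 2 * (∑ i, x i + ∑ i, y i) ∧ (m % 4 = 2 → m ≠ 2 * (∑ i, x i + ∑ i, y i))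
  refine ⟨by omega, fun hm4 heq => ?_⟩
  have hall := (Finset.sum_eq_sum_iff_of_le hle).1 (by rw [hxy, htwo]; omega)
  have hx1 : ∀ i, x (i - 1) + x i + x (i + 1) + y i = 1 := fun i => by
    have h1 := hx i
    have h2 := hy i
    have h3 := hall i (Finset.mem_univ i)
    omega
  have hy1 : ∀ i, y (i - 1) + y i + y (i + 1) + x i = 1 := fun i => by
    have h1 := hx i
    have h2 := hy i
    have h3 := hall i (Finset.mem_univ i)
    omega
  have step : ∀ p q : ZMod m → ℕ, (∀ i, p (i - 1) + p i + p (i + 1) + q i = 1) →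
      (∀ i, q (i - 1) + q i + q (i + 1) + p i = 1) → ∀ i, p i = 1 → q (i + 2) = 1 := by
    intro p q hp hq i hi
    have h1 := hp i
    have h2 := hp (i + 1)
    have h3 := hq (i + 1)
    rw [add_sub_cancel_right, show i + 1 + 1 = i + 2 by ring] at h2 h3
    omega
  have iter : ∀ p q : ZMod m → ℕ, (∀ i, p (i - 1) + p i + p (i + 1) + q i = 1) →
      (∀ i, q (i - 1) + q i + q (i + 1) + p i = 1) → ∀ i, p i ≠ 1 := by
    intro p q hp hq i hi
    have hit : ∀ n : ℕ, p (i + (4 * n : ℕ)) = 1 := by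
      intro n
      induction n with
      | zero => simpa using hi
      | succ n ih =>
        have h1 := step q p hq hp _ (step p q hp hq _ ih)
        rw [show i + ((4 * (n + 1) : ℕ) : ZMod m) = i + (4 * n : ℕ) + 2 + 2 by push_cast; ring]
        exact h1
    have h1 := step p q hp hq _ (hit (m / 4))
    have h2 : i + ((4 * (m / 4) : ℕ) : ZMod m) + 2 = i := by
      have : ((4 * (m / 4) + 2 : ℕ) : ZMod m) = 0 := by
        rw [show 4 * (m / 4) + 2 = m by omega, ZMod.natCast_self]
      push_cast at this ⊢
      rw [add_assoc, this, add_zero]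
    rw [h2] at h1
    have h3 := hp i
    omega
  have h1 := hx1 0
  have h2 := iter x y hx1 hy1
  have h3 := iter y x hy1 hx1 0
  have h4 := h2 (0 - 1)
  have h5 := h2 0
  have h6 := h2 (0 + 1)
  omega

/-! ### Colourings given by sequences -/

/-- The predecessor of `j < m` in the cyclic order of `0, …, m - 1`. -/
def cyclicPrev (m j : ℕ) : ℕ := if j = 0 then m - 1 else j - 1

/-- The successor of `j < m` in the cyclic order of `0, …, m - 1`. -/
def cyclicNext (m j : ℕ) : ℕ := if j + 1 = m then 0 else j + 1

theorem val_sub_one_eq_cyclicPrev {m : ℕ} [NeZero m] (hm : 2 ≤ m) (i : ZMod m) :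
    (i - 1).val = cyclicPrev m i.val := by
  have hi := i.val_lt
  have h : cyclicPrev m i.val < m := by
    unfold cyclicPrev
    split_ifs <;> omega
  rw [← ZMod.val_cast_of_lt h]
  congr 1
  unfold cyclicPrev
  split_ifs with h0
  · rw [Nat.cast_sub (by omega), ZMod.natCast_self, (ZMod.val_eq_zero i).1 h0, Nat.cast_one]
  · rw [Nat.cast_sub (by omega), ZMod.natCast_zmod_val, Nat.cast_one]

theorem val_add_one_eq_cyclicNext {m : ℕ} [NeZero m] (i : ZMod m) :
    (i + 1).val = cyclicNext m i.val := by
  have hi := i.val_lt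
  have h : cyclicNext m i.val < m := by
    unfold cyclicNext
    split_ifs <;> omega
  rw [← ZMod.val_cast_of_lt h]
  congr 1
  unfold cyclicNext
  split_ifs with h0
  · have h1 : ((i.val + 1 : ℕ) : ZMod m) = 0 := by rw [h0, ZMod.natCast_self]
    rwa [Nat.cast_add, ZMod.natCast_zmod_val, Nat.cast_one, ← Nat.cast_zero] at h1
  · rw [Nat.cast_add, ZMod.natCast_zmod_val, Nat.cast_one]

/-- The condition of `k`-rainbow domination at the row `r` of a prism, when the other row is `s`;
both are given by their values at `0, …, m - 1`. -/
def RowDominated (k m : ℕ) (r s : ℕ → Finset ℕ) : Prop :=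
  ∀ j < m, r j ⊆ Finset.Icc 1 k ∧
    (r j = ∅ → r (cyclicPrev m j) ∪ r (cyclicNext m j) ∪ s j = Finset.Icc 1 k)

instance (k m : ℕ) (r s : ℕ → Finset ℕ) : Decidable (RowDominated k m r s) :=
  inferInstanceAs (Decidable (∀ j < m, _ ∧ _))

theorem rowsDominate_of_rowDominated {m : ℕ} [NeZero m] (hm : 2 ≤ m) {k : ℕ} {r s : ℕ → Finset ℕ}
    (hr : RowDominated k m r s) (hs : RowDominated k m s r) :
    RowsDominate k (fun i : ZMod m => r i.val) (fun i : ZMod m => s i.val) := by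
  refine ⟨fun i => (hr _ i.val_lt).1, fun i => (hs _ i.val_lt).1, fun i hi => ?_, fun i hi => ?_⟩
  · simp only [val_sub_one_eq_cyclicPrev hm, val_add_one_eq_cyclicNext]
    exact (hr _ i.val_lt).2 hi
  · simp only [val_sub_one_eq_cyclicPrev hm, val_add_one_eq_cyclicNext]
    exact (hs _ i.val_lt).2 hi

theorem sum_zmod_val {m : ℕ} [NeZero m] (g : ℕ → ℕ) :
    ∑ i : ZMod m, g i.val = ∑ j ∈ Finset.range m, g j := by
  cases m with
  | zero => exact absurd rfl (NeZero.ne 0)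
  | succ n => exact Fin.sum_univ_eq_sum_range g (n + 1)

/-! ### Colourings with one and two colours -/

theorem sum_range_indicator_mod {p c : ℕ} (hp : 0 < p) (hc : c < p) (n : ℕ) :
    ∑ j ∈ Finset.range n, (if j % p = c then 1 else 0) = (n + (p - 1 - c)) / p := by
  induction n with
  | zero => rw [Finset.sum_range_zero, Nat.div_eq_of_lt (by omega)]
  | succ n ih =>
    rw [Finset.sum_range_succ, ih, show n + 1 + (p - 1 - c) = n + (p - 1 - c) + 1 by omega,
      Nat.succ_div]
    have : p ∣ n + (p - 1 - c) + 1 ↔ n % p = c := by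
      rw [Nat.dvd_iff_mod_eq_zero, show n + (p - 1 - c) + 1 = n + (p - c) by omega]
      have h1 := Nat.mod_lt n hp
      rw [Nat.add_mod]
      rcases Nat.eq_zero_or_pos c with rfl | h0
      · simp
      · rw [Nat.mod_eq_of_lt (show p - c < p by omega)]
        constructor
        · intro h
          obtain ⟨d, hd⟩ := Nat.dvd_of_mod_eq_zero h
          have : d = 1 := by
            have h2 : d < 2 := by
              by_contra hlt
              have : p * 2 ≤ p * d := Nat.mul_le_mul_left p (by omega)
              omega
            have h3 : d ≠ 0 := by
              rintro rfl
              omega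
            omega
          subst this
          omega
        · intro h
          rw [h, show c + (p - c) = p by omega, Nat.mod_self]
    simp only [this]

/-- The vertices `u_{4l}` and `v_{4l+2}`, together with `v_{m-1}` if `m ≡ 2` modulo 4, dominate. -/
theorem exists_rowsDominate_one {m : ℕ} [NeZero m] (hm : 3 ≤ m) :
    ∃ X Y : ZMod m → Finset ℕ, RowsDominate 1 X Y ∧
      ∑ i, (X i).card + ∑ i, (Y i).card ≤ (m + 1) / 2 + if m % 4 = 2 then 1 else 0 := by
  let r : ℕ → Finset ℕ := fun j => if j % 4 = 0 then {1} else ∅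
  let s : ℕ → Finset ℕ := fun j => if j % 4 = 2 ∨ m % 4 = 2 ∧ j = m - 1 then {1} else ∅
  have union : ∀ (P Q R : Prop) [Decidable P] [Decidable Q] [Decidable R], P ∨ Q ∨ R →
      (if P then {1} else ∅) ∪ (if Q then {1} else ∅) ∪ (if R then {1} else ∅) =
        Finset.Icc 1 1 := by
    intro P Q R _ _ _ h
    by_cases hP : P <;> by_cases hQ : Q <;> by_cases hR : R <;> simp_all
  have sub : ∀ (P : Prop) [Decidable P], (if P then {1} else ∅) ⊆ Finset.Icc 1 1 := by
    intro P _
    split_ifs <;> simp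
  refine ⟨_, _, rowsDominate_of_rowDominated (r := r) (s := s) (by omega) ?_ ?_, ?_⟩
  · refine fun j hj => ⟨sub _, fun h0 => union _ _ _ ?_⟩
    have h1 : ¬ j % 4 = 0 := by
      intro h
      simp [r, h] at h0
    unfold cyclicPrev cyclicNext
    split_ifs <;> omega
  · refine fun j hj => ⟨sub _, fun h0 => union _ _ _ ?_⟩
    have h1 : ¬ (j % 4 = 2 ∨ m % 4 = 2 ∧ j = m - 1) := by
      intro h
      simp [s, h] at h0
    unfold cyclicPrev cyclicNext
    split_ifs <;> omega
  · rw [sum_zmod_val fun j => (r j).card, sum_zmod_val fun j => (s j).card]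
    have h1 : ∑ j ∈ Finset.range m, (r j).card = (m + 3) / 4 := by
      rw [← sum_range_indicator_mod (p := 4) (c := 0) (by omega) (by omega)]
      refine Finset.sum_congr rfl fun j _ => ?_
      simp only [r]
      split_ifs <;> rfl
    have h2 : ∑ j ∈ Finset.range m, (s j).card ≤ (m + 1) / 4 + if m % 4 = 2 then 1 else 0 := by
      have h3 : ∑ j ∈ Finset.range m, (if j = m - 1 then (if m % 4 = 2 then 1 else 0) else 0) =
          if m % 4 = 2 then 1 else 0 := by
        rw [Finset.sum_ite_eq', if_pos (Finset.mem_range.2 (by omega))]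
      rw [← h3, show (m + 1) / 4 = (m + (4 - 1 - 2)) / 4 from rfl,
        ← sum_range_indicator_mod (p := 4) (c := 2) (by omega) (by omega),
        ← Finset.sum_add_distrib]
      refine Finset.sum_le_sum fun j _ => ?_
      simp only [s]
      split_ifs <;> simp <;> omega
    omega

/-- Colour the vertices `u_j` with `j` even by `1` and the vertices `v_j` with `j` odd by `2`,
where `0 ≤ j < m`. -/
theorem exists_rowsDominate_two {m : ℕ} [NeZero m] (hm : 3 ≤ m) :
    ∃ X Y : ZMod m → Finset ℕ, RowsDominate 2 X Y ∧
      ∑ i, (X i).card + ∑ i, (Y i).card ≤ m := by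
  let r : ℕ → Finset ℕ := fun j => if j % 2 = 0 then {1} else ∅
  let s : ℕ → Finset ℕ := fun j => if j % 2 = 1 then {2} else ∅
  have union : ∀ (a b : ℕ) (P Q R : Prop) [Decidable P] [Decidable Q] [Decidable R],
      ({a, b} : Finset ℕ) = Finset.Icc 1 2 → (P ∨ Q) ∧ R →
      (if P then {a} else ∅) ∪ (if Q then {a} else ∅) ∪ (if R then {b} else ∅) =
        Finset.Icc 1 2 := by
    intro a b P Q R _ _ _ hab h
    rw [← hab]
    by_cases hP : P <;> by_cases hQ : Q <;> by_cases hR : R <;> simp_all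
  refine ⟨_, _, rowsDominate_of_rowDominated (r := r) (s := s) (by omega) ?_ ?_, ?_⟩
  · refine fun j hj => ⟨?_, fun h0 => union 1 2 _ _ _ (by decide) ?_⟩
    · simp only [r]
      split_ifs <;> simp
    have h1 : ¬ j % 2 = 0 := by
      intro h
      simp [r, h] at h0
    unfold cyclicPrev cyclicNext
    split_ifs <;> omega
  · refine fun j hj => ⟨?_, fun h0 => union 2 1 _ _ _ (by decide) ?_⟩
    · simp only [s]
      split_ifs <;> simp
    have h1 : ¬ j % 2 = 1 := by
      intro h
      simp [s, h] at h0
    unfold cyclicPrev cyclicNext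
    split_ifs <;> omega
  · rw [sum_zmod_val fun j => (r j).card, sum_zmod_val fun j => (s j).card,
      ← Finset.sum_add_distrib]
    have : ∀ j ∈ Finset.range m, (r j).card + (s j).card ≤ 1 := by
      intro j _
      simp only [r, s]
      split_ifs <;> first | omega | simp
    simpa using Finset.sum_le_card_nsmul _ _ _ this

/-- Without empty vertices there is nothing to dominate. -/
theorem exists_rowsDominate_of_pos {m : ℕ} [NeZero m] {k : ℕ} (hk : 1 ≤ k) :
    ∃ X Y : ZMod m → Finset ℕ, RowsDominate k X Y ∧
      ∑ i, (X i).card + ∑ i, (Y i).card ≤ 2 * m := by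
  refine ⟨fun _ => {1}, fun _ => {1}, ⟨?_, ?_, ?_, ?_⟩, ?_⟩
  · simpa using hk
  · simpa using hk
  · simp
  · simp
  · simp [ZMod.card, two_mul]

/-! ### Periodic colourings -/

theorem patternRow_eq_of_lt (h T : List (Finset ℕ)) {t t' a b : ℕ} (ha : a < 6 * t)
    (hb : b < 6 * t') (hab : a % 6 = b % 6) : patternRow h T t a = patternRow h T t' b := by
  rw [patternRow, patternRow, if_pos ha, if_pos hb, hab]

theorem patternRow_eq_of_ge (h T : List (Finset ℕ)) {t t' a b : ℕ} (ha : 6 * t ≤ a)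
    (hb : 6 * t' ≤ b) (hab : a - 6 * t = b - 6 * t') :
    patternRow h T t a = patternRow h T t' b := by
  rw [patternRow, patternRow, if_neg (by omega), if_neg (by omega), hab]

/-- Any three cyclically consecutive columns of a pattern with its head repeated occur also in the
cyclic repetition of the head alone or in the pattern that contains its head once. -/
theorem rowDominated_patternRow {k s t : ℕ} (ht : 1 ≤ t) {hU tU hV tV : List (Finset ℕ)}
    (hhead : RowDominated k 6 (patternRow hU tU 1) (patternRow hV tV 1))
    (hone : RowDominated k (6 + s) (patternRow hU tU 1) (patternRow hV tV 1)) :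
    RowDominated k (6 * t + s) (patternRow hU tU t) (patternRow hV tV t) := by
  have eq : ∀ (h T : List (Finset ℕ)) (a b : ℕ),
      (a < 6 * t ∧ b < 6 ∧ a % 6 = b) ∨ (6 * t ≤ a ∧ 6 ≤ b ∧ a - 6 * t = b - 6) →
      patternRow h T t a = patternRow h T 1 b := by
    rintro h T a b (⟨h1, h2, h3⟩ | ⟨h1, h2, h3⟩)
    · exact patternRow_eq_of_lt h T h1 (by omega) (by omega)
    · exact patternRow_eq_of_ge h T h1 (by omega) (by omega)
  intro j hj
  have transfer : ∀ n b : ℕ, RowDominated k n (patternRow hU tU 1) (patternRow hV tV 1) → b < n →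
      ((j < 6 * t ∧ b < 6 ∧ j % 6 = b) ∨ (6 * t ≤ j ∧ 6 ≤ b ∧ j - 6 * t = b - 6)) →
      (∀ h T : List (Finset ℕ), patternRow h T t (cyclicPrev (6 * t + s) j) =
        patternRow h T 1 (cyclicPrev n b)) →
      (∀ h T : List (Finset ℕ), patternRow h T t (cyclicNext (6 * t + s) j) =
        patternRow h T 1 (cyclicNext n b)) →
      patternRow hU tU t j ⊆ Finset.Icc 1 k ∧ (patternRow hU tU t j = ∅ →
        patternRow hU tU t (cyclicPrev (6 * t + s) j) ∪
          patternRow hU tU t (cyclicNext (6 * t + s) j) ∪ patternRow hV tV t j =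
            Finset.Icc 1 k) := by
    intro n b hn hb hjb hp hq
    rw [hp, hq, eq hU tU j b hjb, eq hV tV j b hjb]
    exact hn b hb
  by_cases htail : 6 * t ≤ j
  · refine transfer (6 + s) (j - 6 * t + 6) hone (by omega) (by omega)
      (fun h T => eq _ _ _ _ ?_) (fun h T => eq _ _ _ _ ?_)
    all_goals simp only [cyclicPrev, cyclicNext]; split_ifs <;> first | contradiction | omega
  · -- at a border of two copies of the head the window is one of the head alone
    by_cases hin : (j % 6 = 0 ∧ j ≠ 0) ∨ (j % 6 = 5 ∧ j + 1 ≠ 6 * t)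
    · refine transfer 6 (j % 6) hhead (by omega) (by omega)
        (fun h T => eq _ _ _ _ ?_) (fun h T => eq _ _ _ _ ?_)
      all_goals simp only [cyclicPrev, cyclicNext]; split_ifs <;> omega
    · refine transfer (6 + s) (j % 6) hone (by omega) (by omega)
        (fun h T => eq _ _ _ _ ?_) (fun h T => eq _ _ _ _ ?_)
      all_goals simp only [cyclicPrev, cyclicNext]; split_ifs <;> omega

/-- The finitely many conditions under which the pattern `P` with `s` last columns dominates
`Pr(6 t + s)` for all `t` with `6 t + s ≥ 3`. -/
abbrev PrismPattern.IsValid (P : PrismPattern) (k s : ℕ) : Prop :=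
  (RowDominated k 6 (patternRow P.uHead P.uTail 1) (patternRow P.vHead P.vTail 1) ∧
    RowDominated k 6 (patternRow P.vHead P.vTail 1) (patternRow P.uHead P.uTail 1)) ∧
  (RowDominated k (6 + s) (patternRow P.uHead P.uTail 1) (patternRow P.vHead P.vTail 1) ∧
    RowDominated k (6 + s) (patternRow P.vHead P.vTail 1) (patternRow P.uHead P.uTail 1)) ∧
  (3 ≤ s → RowDominated k s (patternRow P.uHead P.uTail 0) (patternRow P.vHead P.vTail 0) ∧
    RowDominated k s (patternRow P.vHead P.vTail 0) (patternRow P.uHead P.uTail 0))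

theorem PrismPattern.IsValid.rowsDominate {m : ℕ} [NeZero m] (hm : 3 ≤ m) {P : PrismPattern}
    {k : ℕ} (h : P.IsValid k (m % 6)) :
    RowsDominate k (fun i : ZMod m => P.toFun m (Sum.inl i))
      (fun i : ZMod m => P.toFun m (Sum.inr i)) := by
  obtain ⟨⟨h1, h2⟩, ⟨h3, h4⟩, h5⟩ := h
  refine rowsDominate_of_rowDominated (r := patternRow P.uHead P.uTail (m / 6))
    (s := patternRow P.vHead P.vTail (m / 6)) (by omega) ?_ ?_
  · rcases Nat.eq_zero_or_pos (m / 6) with h0 | hpos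
    · have := (h5 (by omega)).1
      rwa [show m % 6 = m by omega, ← h0] at this
    · have := rowDominated_patternRow hpos h1 h3
      rwa [Nat.div_add_mod] at this
  · rcases Nat.eq_zero_or_pos (m / 6) with h0 | hpos
    · have := (h5 (by omega)).2
      rwa [show m % 6 = m by omega, ← h0] at this
    · have := rowDominated_patternRow hpos h2 h4
      rwa [Nat.div_add_mod] at this

/-- The weight of the six columns that are repeated. -/
def PrismPattern.headWeight (P : PrismPattern) : ℕ :=
  ∑ j ∈ Finset.range 6, ((P.uHead.getD j ∅).card + (P.vHead.getD j ∅).card)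

/-- The weight of the last `s` columns. -/
def PrismPattern.tailWeight (P : PrismPattern) (s : ℕ) : ℕ :=
  ∑ j ∈ Finset.range s, ((P.uTail.getD j ∅).card + (P.vTail.getD j ∅).card)

theorem sum_range_patternRow (h T : List (Finset ℕ)) (t s : ℕ) :
    ∑ j ∈ Finset.range (6 * t + s), (patternRow h T t j).card =
      t * ∑ j ∈ Finset.range 6, (h.getD j ∅).card + ∑ j ∈ Finset.range s, (T.getD j ∅).card := by
  rw [Finset.sum_range_add]
  congr 1
  · have h1 : ∀ n, ∑ j ∈ Finset.range (6 * n), (h.getD (j % 6) ∅).card =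
        n * ∑ j ∈ Finset.range 6, (h.getD j ∅).card := by
      intro n
      induction n with
      | zero => simp
      | succ n ih =>
        have h2 : ∑ j ∈ Finset.range 6, (h.getD ((6 * n + j) % 6) ∅).card =
            ∑ j ∈ Finset.range 6, (h.getD j ∅).card :=
          Finset.sum_congr rfl fun j hj => by
            rw [Nat.mul_add_mod, Nat.mod_eq_of_lt (Finset.mem_range.1 hj)]
        rw [Nat.mul_succ, Finset.sum_range_add, ih, h2, Nat.succ_mul]
    rw [← h1]
    refine Finset.sum_congr rfl fun j hj => ?_
    rw [patternRow, if_pos (Finset.mem_range.1 hj)]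
  · refine Finset.sum_congr rfl fun j _ => ?_
    rw [patternRow, if_neg (by omega), Nat.add_sub_cancel_left]

theorem PrismPattern.sum_card_toFun {m : ℕ} [NeZero m] (P : PrismPattern) :
    ∑ i : ZMod m, (P.toFun m (Sum.inl i)).card + ∑ i : ZMod m, (P.toFun m (Sum.inr i)).card =
      m / 6 * P.headWeight + P.tailWeight (m % 6) := by
  have h1 := sum_range_patternRow P.uHead P.uTail (m / 6) (m % 6)
  have h2 := sum_range_patternRow P.vHead P.vTail (m / 6) (m % 6)
  rw [Nat.div_add_mod] at h1 h2
  simp only [PrismPattern.toFun]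
  rw [sum_zmod_val fun j => (patternRow P.uHead P.uTail (m / 6) j).card,
    sum_zmod_val fun j => (patternRow P.vHead P.vTail (m / 6) j).card, h1, h2,
    PrismPattern.headWeight, PrismPattern.tailWeight, Finset.sum_add_distrib,
    Finset.sum_add_distrib]
  ring

/-- A table of patterns for three colours, by the residue of `m` modulo 6
(the last case is residue 5). -/
def prismPatternThree (s : ℕ) : PrismPattern where
  uHead := [{1}, ∅, {3}, ∅, {2}, ∅]
  vHead := [∅, {2}, ∅, {1}, ∅, {3}]
  uTail := match s with
    | 0 => []
    | 1 => [{1}]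
    | 2 => [{1}, ∅]
    | 3 => [{1}, ∅, {3}]
    | 4 => [{1}, ∅, {3}, ∅]
    | _ => [{1}, ∅, {3}, ∅, {2}]
  vTail := match s with
    | 0 => []
    | 1 => [{3}]
    | 2 => [∅, {2, 3}]
    | 3 => [∅, {2}, {3}]
    | 4 => [∅, {2}, ∅, {1, 2, 3}]
    | _ => [∅, {2}, ∅, {1}, {3}]

theorem prismPatternThree_isValid : ∀ s < 6, (prismPatternThree s).IsValid 3 s := by decide

theorem prismPatternFour_isValid : ∀ s < 6, (prismPatternFour s).IsValid 4 s := by decide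

theorem prismPatternFive_isValid : ∀ s < 6, (prismPatternFive s).IsValid 5 s := by decide

theorem prismPatternThree_weight : ∀ s < 6, (prismPatternThree s).headWeight = 6 ∧
    (prismPatternThree s).tailWeight s =
      s + (if s = 0 then 0 else if s = 4 then 2 else 1) := by decide

theorem prismPatternFour_weight : ∀ s < 6, (prismPatternFour s).headWeight = 8 ∧
    (prismPatternFour s).tailWeight s =
      (4 * s + 2) / 3 + (if s = 0 ∨ s = 1 then 0 else 1) := by decide

theorem prismPatternFive_weight : ∀ s < 6, (prismPatternFive s).headWeight = 10 ∧
    (prismPatternFive s).tailWeight s =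
      (5 * s + 2) / 3 + (if s = 3 ∨ s = 4 then 1 else 0) := by decide

/-! ### The rainbow domination numbers of prisms -/

theorem natCeil_cast_div (a b : ℕ) (hb : 0 < b) : ⌈(a : ℚ) / b⌉₊ = (a + b - 1) / b := by
  refine eq_of_forall_ge_iff fun c => ?_
  rw [Nat.ceil_le, div_le_iff₀ (by exact_mod_cast hb), Nat.div_le_iff_le_mul_add_pred hb,
    mul_comm (c : ℚ)]
  norm_cast
  omega

/-- The lower bounds for `3 ≤ k ≤ 5` in a common form: the weight is at least `2 k ⌊m / 6⌋ + e` for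
every `e` that the bound for the residue of `m` modulo 6 admits. For residues 2 and 4 the bounds of
both cases of `le_weight_of_even` have to admit it. -/
theorem RowsDominate.le_weight {m : ℕ} [NeZero m] {k : ℕ} (hm : 3 ≤ m) (h3 : 3 ≤ k) (h5 : k ≤ 5)
    {X Y : ZMod m → Finset ℕ} (h : RowsDominate k X Y) {e : ℕ}
    (hodd : m % 2 = 1 → 18 * e < 6 * (k * (m % 6)) + (24 - 4 * k) + 18)
    (h0 : m % 6 = 0 → e = 0) (h2 : m % 6 = 2 → e ≤ k ∧ 18 * e < 6 * (k * 2) + (36 - 6 * k) + 18)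
    (h4 : m % 6 = 4 → e ≤ 2 * k ∧ 18 * e ≤ 6 * (k * 4) + (36 - 6 * k) + 18) :
    2 * k * (m / 6) + e ≤ ∑ i, (X i).card + ∑ i, (Y i).card := by
  set w := ∑ i, (X i).card + ∑ i, (Y i).card with hw
  have hkm : k * m = 3 * (2 * k * (m / 6)) + k * (m % 6) := by
    conv_lhs => rw [← Nat.div_add_mod m 6]
    ring
  rcases Nat.mod_two_eq_zero_or_one m with hev | hod
  · rcases h.le_weight_of_even (by omega) h3 h5 hev with hcase | ⟨hcase, hstrict⟩
    · rw [← hw] at hcase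
      obtain hs | hs | hs : m % 6 = 0 ∨ m % 6 = 2 ∨ m % 6 = 4 := by omega
      · have e1 : k * ((m + 2) / 3) = 2 * k * (m / 6) := by
          rw [show (m + 2) / 3 = 2 * (m / 6) by omega]
          ring
        have := h0 hs
        omega
      · have e1 : k * ((m + 2) / 3) = 2 * k * (m / 6) + k := by
          rw [show (m + 2) / 3 = 2 * (m / 6) + 1 by omega]
          ring
        have := h2 hs
        omega
      · have e1 : k * ((m + 2) / 3) = 2 * k * (m / 6) + 2 * k := by
          rw [show (m + 2) / 3 = 2 * (m / 6) + 2 by omega]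
          ring
        have := h4 hs
        omega
    · rw [← hw] at hcase hstrict
      obtain hs | hs | hs : m % 6 = 0 ∨ m % 6 = 2 ∨ m % 6 = 4 := by omega
      · rw [hs] at hkm
        have := h0 hs
        omega
      · rw [hs] at hkm
        have := h2 hs
        omega
      · rw [hs] at hkm
        have := h4 hs
        have := hstrict (by omega)
        omega
  · have h1 := h.le_weight_of_odd h3 (by omega) hod
    rw [← hw] at h1
    have := hodd hod
    omega

end SimpleGraph

open SimpleGraph in
theorem mainTheorem4 (m : ℕ) [NeZero m] (hm : 3 ≤ m) :
    (SimpleGraph.prism m).rainbowDominationNumber 1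
        = ⌈(m : ℚ) / 2⌉₊ + (if m % 4 = 2 then 1 else 0) ∧
    (SimpleGraph.prism m).rainbowDominationNumber 2 = m ∧
    (SimpleGraph.prism m).rainbowDominationNumber 3
        = m + (if m % 6 = 0 then 0 else if m % 6 = 4 then 2 else 1) ∧
    (SimpleGraph.prism m).rainbowDominationNumber 4
        = ⌈(4 * m : ℚ) / 3⌉₊ + (if m % 6 = 0 ∨ m % 6 = 1 then 0 else 1) ∧
    (SimpleGraph.prism m).rainbowDominationNumber 5
        = ⌈(5 * m : ℚ) / 3⌉₊ + (if m % 6 = 3 ∨ m % 6 = 4 then 1 else 0) ∧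
    (∀ k : ℕ, 6 ≤ k → (SimpleGraph.prism m).rainbowDominationNumber k = 2 * m) ∧
    (m % 6 = 0 → ∀ k : ℕ, 3 ≤ k → k ≤ 6 →
      ((SimpleGraph.prism m).rainbowDominationNumber k : ℚ) = (k * m : ℚ) / 3) ∧
    (SimpleGraph.prism m).IsGammaFunction 4 ((SimpleGraph.prismPatternFour (m % 6)).toFun m) ∧
    (SimpleGraph.prism m).IsGammaFunction 5 ((SimpleGraph.prismPatternFive (m % 6)).toFun m) := by
  have hs : m % 6 < 6 := Nat.mod_lt _ (by omega)
  have hm6 := Nat.div_add_mod m 6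
  have c1 : ⌈(m : ℚ) / 2⌉₊ = (m + 1) / 2 := by
    have := natCeil_cast_div m 2 (by omega)
    exact_mod_cast this
  have c4 : ⌈(4 * m : ℚ) / 3⌉₊ = (4 * m + 2) / 3 := by
    have := natCeil_cast_div (4 * m) 3 (by omega)
    push_cast at this
    exact this
  have c5 : ⌈(5 * m : ℚ) / 3⌉₊ = (5 * m + 2) / 3 := by
    have := natCeil_cast_div (5 * m) 3 (by omega)
    push_cast at this
    exact this
  have v3 := prismPatternThree_isValid _ hs
  have v4 := prismPatternFour_isValid _ hs
  have v5 := prismPatternFive_isValid _ hs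
  have w4 : ∑ i : ZMod m, ((prismPatternFour (m % 6)).toFun m (Sum.inl i)).card +
      ∑ i : ZMod m, ((prismPatternFour (m % 6)).toFun m (Sum.inr i)).card =
        (4 * m + 2) / 3 + (if m % 6 = 0 ∨ m % 6 = 1 then 0 else 1) := by
    obtain ⟨h1, h2⟩ := prismPatternFour_weight _ hs
    rw [PrismPattern.sum_card_toFun, h1, h2]
    omega
  have w5 : ∑ i : ZMod m, ((prismPatternFive (m % 6)).toFun m (Sum.inl i)).card +
      ∑ i : ZMod m, ((prismPatternFive (m % 6)).toFun m (Sum.inr i)).card =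
        (5 * m + 2) / 3 + (if m % 6 = 3 ∨ m % 6 = 4 then 1 else 0) := by
    obtain ⟨h1, h2⟩ := prismPatternFive_weight _ hs
    rw [PrismPattern.sum_card_toFun, h1, h2]
    omega
  have g1 : (prism m).rainbowDominationNumber 1 = (m + 1) / 2 + (if m % 4 = 2 then 1 else 0) := by
    refine rainbowDominationNumber_prism_eq hm (exists_rowsDominate_one hm) fun X Y h => ?_
    obtain ⟨h1, h2⟩ := h.le_weight_one
    split_ifs with h4
    · have := h2 h4
      omega
    · omega
  have g2 : (prism m).rainbowDominationNumber 2 = m :=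
    rainbowDominationNumber_prism_eq hm (exists_rowsDominate_two hm) fun X Y h => h.le_weight_two
  have g3 : (prism m).rainbowDominationNumber 3 =
      m + (if m % 6 = 0 then 0 else if m % 6 = 4 then 2 else 1) := by
    refine rainbowDominationNumber_prism_eq hm ⟨_, _, v3.rowsDominate hm, ?_⟩ fun X Y h => ?_
    · obtain ⟨h1, h2⟩ := prismPatternThree_weight _ hs
      rw [PrismPattern.sum_card_toFun, h1, h2]
      omega
    · have := h.le_weight hm (by omega) (by omega)
        (e := m % 6 + (if m % 6 = 0 then 0 else if m % 6 = 4 then 2 else 1))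
        (by split_ifs <;> omega) (by split_ifs <;> omega) (by split_ifs <;> omega)
        (by split_ifs <;> omega)
      omega
  have g4 : (prism m).rainbowDominationNumber 4 =
      (4 * m + 2) / 3 + (if m % 6 = 0 ∨ m % 6 = 1 then 0 else 1) := by
    refine rainbowDominationNumber_prism_eq hm ⟨_, _, v4.rowsDominate hm, w4.le⟩ fun X Y h => ?_
    have := h.le_weight hm (by omega) (by omega)
      (e := (4 * (m % 6) + 2) / 3 + (if m % 6 = 0 ∨ m % 6 = 1 then 0 else 1))
      (by split_ifs <;> omega) (by split_ifs <;> omega) (by split_ifs <;> omega)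
      (by split_ifs <;> omega)
    omega
  have g5 : (prism m).rainbowDominationNumber 5 =
      (5 * m + 2) / 3 + (if m % 6 = 3 ∨ m % 6 = 4 then 1 else 0) := by
    refine rainbowDominationNumber_prism_eq hm ⟨_, _, v5.rowsDominate hm, w5.le⟩ fun X Y h => ?_
    have := h.le_weight hm (by omega) (by omega)
      (e := (5 * (m % 6) + 2) / 3 + (if m % 6 = 3 ∨ m % 6 = 4 then 1 else 0))
      (by split_ifs <;> omega) (by split_ifs <;> omega) (by split_ifs <;> omega)
      (by split_ifs <;> omega)
    omega
  have g6 : ∀ k : ℕ, 6 ≤ k → (prism m).rainbowDominationNumber k = 2 * m := by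
    intro k hk
    refine rainbowDominationNumber_prism_eq hm (exists_rowsDominate_of_pos (by omega))
      fun X Y h => ?_
    have := discharge (k := 6) (by omega) le_rfl (fun i => (X i).card) (fun i => (Y i).card)
      (fun i hi => hk.trans (h.le_card i hi)) (fun i hi => hk.trans (h.symm.le_card i hi))
    omega
  refine ⟨by rw [c1, g1], g2, g3, by rw [c4, g4], by rw [c5, g5], g6, ?_, ?_, ?_⟩
  · intro h0 k hk3 hk6
    rw [eq_div_iff (by norm_num)]
    norm_cast
    interval_cases k
    · rw [g3, if_pos h0]
      ring
    · rw [g4, if_pos (Or.inl h0)]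
      omega
    · rw [g5, if_neg (by omega)]
      omega
    · rw [g6 6 le_rfl]
      ring
  · exact ⟨(isRainbowDominating_prism_iff hm 4 _).2 (v4.rowsDominate hm),
      by rw [rainbowWeight_prism, g4, w4]⟩
  · exact ⟨(isRainbowDominating_prism_iff hm 5 _).2 (v5.rowsDominate hm),
      by rw [rainbowWeight_prism, g5, w5]⟩
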